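/- Let $\mathcal X,\mathcal Y$ be sets of inputs and $\mathcal A,\mathcal B$ finite sets of outputs. A *distribution* $\mathbf p$ is a family $p(a,b|x,y)\ge 0$ with $\sum_{a\in\mathcal A,\,b\in\mathcal B}p(a,b|x,y)=1$ for all $x\in\mathcal X$, $y\in\mathcal Y$. Write $|\mathbf p-\mathbf p'|_1\le\epsilon$ if $\sum_{a,b}|p(a,b|x,y)-p'(a,b|x,y)|\le\epsilon$ for all $x,y$. Logarithms are to base $2$, with $\log 0=-\infty$, $\log\infty=\infty$ and $\inf\emptyset=+\infty$. *Efficiency bound.* Let $\bot\notin\mathcal A\cup\mathcal B$ be an abort symbol. Let $\mathcal Q^\bot$ be the set of distributions $\mathbf q$ with outputs in $(\mathcal A\cup\{\bot\})\times(\mathcal B\cup\{\bot\})$ of the form $q(a,b|x,y)=\mathrm{Tr}\big((E^x_a\otimes F^y_b)\rho\big)$, where $\rho$ is a density operator on a tensor product of two finite-dimensional complex Hilbert spaces, of arbitrary dimensions, and, for all $x,y$, $(E^x_a)_a$ and $(F^y_b)_b$ are measurements (POVMs) on the first and on the second factor. Put $$\mathrm{eff}^*(\mathbf p)=\Big(\sup\{\zeta\ge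 0:\ \exists\,\mathbf q\in\mathcal Q^\bot\ \ \forall x,y\ \ \forall (a,b)\in\mathcal A\times\mathcal B\quad q(a,b|x,y)=\zeta\,p(a,b|x,y)\}\Big)^{-1}\in[0,\infty],$$ with $0^{-1}=\infty$ and $\infty^{-1}=0$, and $\mathrm{eff}^*_\epsilon(\mathbf p)=\inf\{\mathrm{eff}^*(\mathbf p'):\ \mathbf p'\text{ a distribution},\ |\mathbf p'-\mathbf p|_1\le\epsilon\}$. *Communication.* In an entanglement-assisted quantum protocol Alice and Bob hold the two parts of a shared finite-dimensional bipartite state, which does not depend on the inputs $x$ (given to Alice) and $y$ (given to Bob). In each step one of them, according to a schedule that does not depend on the inputs, applies to the register that player holds a linear isometry that depends on that player's input and splits off one qubit (that is, a unitary acting on the register and fresh ancillas), and sends this qubit to the other player. In the end each player measures the register held, by a POVM depending on that player's input, and outputs the outcome. Let $Q^*_\epsilon(\mathbf p)\in\{0,1,2,\dots\}\cup\{\infty\}$ be the least number of qubits sent in total by such a protocol whose output distribution $\mathbf p'$ satisfies $|\mathbf p'-\mathbf p|_1\le\epsilon$. **Theorem 3.5.** For every distribution $\mathbf p$ and every real $\epsilon$,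 $$Q^*_\epsilon(\mathbf p)\ \ge\ \tfrac12\log \mathrm{eff}^*_\epsilon(\mathbf p).$$ -/

import Mathlib

open scoped ENNReal NNReal Kronecker Matrix ComplexOrder

namespace QComm

universe u v w z

/-- `p x y a b` is the probability `p(a,b|x,y)`: for every input pair `(x, y)` the numbers
`p x y a b` form a probability distribution on the output pairs. -/
def IsDistribution {X : Type u} {Y : Type v} {A : Type w} {B : Type z} [Fintype A] [Fintype B]
    (p : X → Y → A → B → ℝ) : Prop :=
  (∀ x y a b, 0 ≤ p x y a b) ∧ ∀ x y, ∑ a, ∑ b, p x y a b = 1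

/-- `|p - p'|₁ ≤ ε`: for every input pair the `ℓ¹` distance of the output distributions is at
most `ε`. -/
def L1Close {X : Type u} {Y : Type v} {A : Type w} {B : Type z} [Fintype A] [Fintype B]
    (ε : ℝ) (p p' : X → Y → A → B → ℝ) : Prop :=
  ∀ x y, ∑ a, ∑ b, |p x y a b - p' x y a b| ≤ ε

/-- A (mixed) quantum state on a finite-dimensional register with computational basis `I`. -/
def IsDensity {I : Type} [Fintype I] (ρ : Matrix I I ℂ) : Prop :=
  ρ.PosSemidef ∧ ρ.trace = 1

/-- A quantum measurement (POVM) with outcomes in `O` on the register with basis `I`. -/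
structure POVM (O : Type w) [Fintype O] (I : Type) [Fintype I] [DecidableEq I] where
  effect : O → Matrix I I ℂ
  posSemidef : ∀ o, (effect o).PosSemidef
  sum_eq_one : ∑ o, effect o = 1

/-- A linear isometry from the register with basis `I` to the register with basis `I'`; every
such map is a unitary applied to the register together with fresh ancillas, and conversely. -/
structure Isometry (I I' : Type) [Fintype I] [Fintype I'] [DecidableEq I] where
  mat : Matrix I' I ℂ
  isometry : matᴴ * mat = 1

/-- Born rule for local measurements with effects `E` (Alice) and `F` (Bob) on the state `ρ`. -/
noncomputable def born {I J : Type} [Fintype I] [Fintype J]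
    (ρ : Matrix (I × J) (I × J) ℂ) (E : Matrix I I ℂ) (F : Matrix J J ℂ) : ℝ :=
  ((E ⊗ₖ F) * ρ).trace.re

/-- Quantum distributions: those obtained, without communication, by local measurements (each
depending on that player's input only) on the two parts of a shared bipartite state. -/
def IsQuantum {X : Type u} {Y : Type v} {A : Type w} {B : Type z} [Fintype A] [Fintype B]
    (q : X → Y → A → B → ℝ) : Prop :=
  ∃ (I J : Type) (_ : Fintype I) (_ : DecidableEq I) (_ : Fintype J) (_ : DecidableEq J)
    (ρ : Matrix (I × J) (I × J) ℂ) (E : X → POVM A I) (F : Y → POVM B J),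
    IsDensity ρ ∧ ∀ x y a b, q x y a b = born ρ ((E x).effect a) ((F y).effect b)

/-- `ζ` is an efficiency with which `p` can be simulated without communication using shared
entanglement: some quantum distribution with the additional abort output `⊥ = none` for each
player satisfies `q(a,b|x,y) = ζ p(a,b|x,y)` for all non-abort outputs. -/
def FeasibleEfficiency {X : Type u} {Y : Type v} {A : Type w} {B : Type z}
    [Fintype A] [Fintype B] (p : X → Y → A → B → ℝ) (ζ : ℝ≥0) : Prop :=
  ∃ q : X → Y → Option A → Option B → ℝ, IsQuantum q ∧
    ∀ x y a b, q x y (some a) (some b) = ζ * p x y a b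

/-- `eff*(p)`, the inverse of the optimal efficiency (with `1 / 0 = ∞`). -/
noncomputable def effStar {X : Type u} {Y : Type v} {A : Type w} {B : Type z}
    [Fintype A] [Fintype B] (p : X → Y → A → B → ℝ) : ℝ≥0∞ :=
  (⨆ (ζ : ℝ≥0) (_ : FeasibleEfficiency p ζ), (ζ : ℝ≥0∞))⁻¹

/-- `eff*_ε(p)`, the infimum of `eff*(p')` over the distributions `p'` with `|p' - p|₁ ≤ ε`. -/
noncomputable def effStarErr {X : Type u} {Y : Type v} {A : Type w} {B : Type z}
    [Fintype A] [Fintype B] (ε : ℝ) (p : X → Y → A → B → ℝ) : ℝ≥0∞ :=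
  ⨅ (p' : X → Y → A → B → ℝ) (_ : IsDistribution p' ∧ L1Close ε p' p), effStar p'

/-- Two-party quantum communication protocols, starting with Alice holding a register with basis
`I` and Bob holding one with basis `J`. A protocol either ends, with a local measurement by each
player that gives that player's output, or one player applies a local isometry (depending on
that player's input) that splits off one qubit, and hands this qubit to the other player. Who
sends at which step is fixed, independently of the inputs. -/
inductive QProtocol (X : Type u) (Y : Type v) (A : Type w) (B : Type z)
    [Fintype A] [Fintype B] : (I J : Type) → [Fintype I] → [DecidableEq I] →
      [Fintype J] → [DecidableEq J] → Type (max u v w z 1) where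
  | measure {I J : Type} [Fintype I] [DecidableEq I] [Fintype J] [DecidableEq J]
      (E : X → POVM A I) (F : Y → POVM B J) : QProtocol X Y A B I J
  | aliceSends {I I' J : Type} [Fintype I] [DecidableEq I] [Fintype I'] [DecidableEq I']
      [Fintype J] [DecidableEq J] (U : X → Isometry I (I' × Fin 2))
      (next : QProtocol X Y A B I' (Fin 2 × J)) : QProtocol X Y A B I J
  | bobSends {I J J' : Type} [Fintype I] [DecidableEq I] [Fintype J] [DecidableEq J]
      [Fintype J'] [DecidableEq J'] (V : Y → Isometry J (Fin 2 × J'))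
      (next : QProtocol X Y A B (I × Fin 2) J') : QProtocol X Y A B I J

namespace QProtocol

/-- The number of qubits communicated. -/
def cost {X : Type u} {Y : Type v} {A : Type w} {B : Type z} [Fintype A] [Fintype B]
    {I J : Type} [Fintype I] [DecidableEq I] [Fintype J] [DecidableEq J]
    (P : QProtocol X Y A B I J) : ℕ :=
  match P with
  | measure _ _ => 0
  | aliceSends _ next => next.cost + 1
  | bobSends _ next => next.cost + 1

/-- `P.prob ρ x y a b` is the probability that the protocol `P`, started in the joint state `ρ`
with inputs `x` and `y`, ends with the outputs `a` for Alice and `b` for Bob. -/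
noncomputable def prob {X : Type u} {Y : Type v} {A : Type w} {B : Type z}
    [Fintype A] [Fintype B]
    {I J : Type} [Fintype I] [DecidableEq I] [Fintype J] [DecidableEq J]
    (P : QProtocol X Y A B I J) (ρ : Matrix (I × J) (I × J) ℂ) (x : X) (y : Y) (a : A) (b : B) :
    ℝ :=
  match P with
  | measure E F => born ρ ((E x).effect a) ((F y).effect b)
  | aliceSends (I' := I') U next =>
      let K := (U x).mat ⊗ₖ (1 : Matrix J J ℂ)
      next.prob (Matrix.reindex (Equiv.prodAssoc I' (Fin 2) J) (Equiv.prodAssoc I' (Fin 2) J)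
        (K * ρ * Kᴴ)) x y a b
  | bobSends (J' := J') V next =>
      let K := (1 : Matrix I I ℂ) ⊗ₖ (V y).mat
      next.prob (Matrix.reindex (Equiv.prodAssoc I (Fin 2) J').symm
        (Equiv.prodAssoc I (Fin 2) J').symm (K * ρ * Kᴴ)) x y a b

end QProtocol

/-- Some entanglement-assisted protocol (with an arbitrary shared initial state, independent of
the inputs) communicates exactly `t` qubits and produces the distribution `p`. -/
def ProducedWithQubits {X : Type u} {Y : Type v} {A : Type w} {B : Type z}
    [Fintype A] [Fintype B] (t : ℕ) (p : X → Y → A → B → ℝ) : Prop :=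
  ∃ (I J : Type) (_ : Fintype I) (_ : DecidableEq I) (_ : Fintype J) (_ : DecidableEq J)
    (ρ : Matrix (I × J) (I × J) ℂ) (P : QProtocol X Y A B I J),
    IsDensity ρ ∧ P.cost = t ∧ ∀ x y a b, P.prob ρ x y a b = p x y a b

/-- `Q*_ε(p)`, the least number of qubits with which some distribution `p'` with
`|p' - p|₁ ≤ ε` is produced with the help of shared entanglement (`∞` if there is none). -/
noncomputable def QStar {X : Type u} {Y : Type v} {A : Type w} {B : Type z}
    [Fintype A] [Fintype B] (ε : ℝ) (p : X → Y → A → B → ℝ) : ℕ∞ :=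
  ⨅ (t : ℕ) (_ : ∃ p' : X → Y → A → B → ℝ, ProducedWithQubits t p' ∧ L1Close ε p' p), (t : ℕ∞)

/-- The logarithm to base two, with `log₂ 0 = -∞` and `log₂ ∞ = ∞`. -/
noncomputable def log2 (r : ℝ≥0∞) : EReal :=
  ENNReal.log r / ((Real.log 2 : ℝ) : EReal)

end QComm

open QComm

/-! A sent qubit can be replaced by postselected teleportation. The sender projects the qubit onto a
Bell state together with one half of a shared maximally entangled pair and aborts on failure. On
success the other half carries the qubit exactly, with no Pauli correction, so the receiver needs no
message. Each success has probability 1/4, whatever the state and inputs, so a protocol with `t`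
qubits yields local measurements whose non-abort statistics are exactly `4 ^ (-t)` times its own.
Hence `eff* ≤ 4 ^ t`.

Effects are pulled back rather than states evolved: `contract_steer_left` and `contract_steer_right`
handle one message, `QProtocol.exists_simulation` iterates them, and
`ProducedWithQubits.feasibleEfficiency` normalizes the shared resource. -/

namespace QComm

/-! ### Bell projections as local measurements -/

section Steering

variable {I I' K : Type} [Fintype I] [DecidableEq I] [Fintype I'] [DecidableEq I']
  [Fintype K] [DecidableEq K]

/-- The unnormalized contraction with the maximally entangled state of the qubit that is split
off and the qubit of the shared resource. -/
def bellContraction (I' K : Type) [DecidableEq I'] [DecidableEq K] :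
    Matrix (I' × K) ((I' × Fin 2) × (K × Fin 2)) ℂ :=
  Matrix.of fun u v => if u.1 = v.1.1 ∧ u.2 = v.2.1 ∧ v.1.2 = v.2.2 then 1 else 0

lemma bellContraction_mul_conjTranspose :
    bellContraction I' K * (bellContraction I' K)ᴴ = (2 : ℂ) • 1 := by
  ext ⟨u, k⟩ ⟨u', k'⟩
  simp only [bellContraction, Matrix.mul_apply, Matrix.of_apply, Matrix.conjTranspose_apply,
    Fintype.sum_prod_type, Fin.sum_univ_two, Matrix.smul_apply, Matrix.one_apply]
  by_cases h : u = u' <;> by_cases h' : k = k' <;>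
    simp [ite_and, h, h', eq_comm, Finset.sum_add_distrib]
  norm_num

/-- The unnormalized Bell vector has squared norm 2, so half of `Tᴴ * T` is an orthogonal
projection. Its complement is the failure event. -/
lemma posSemidef_one_sub_bellContraction :
    (1 - (1 / 2 : ℂ) • ((bellContraction I' K)ᴴ * bellContraction I' K)).PosSemidef := by
  set T := bellContraction I' K with hT
  have hTT : T * Tᴴ = (2 : ℂ) • 1 := bellContraction_mul_conjTranspose
  set P := (1 / 2 : ℂ) • (Tᴴ * T) with hP
  have hPP : P * P = P := by
    rw [hP, Matrix.smul_mul, Matrix.mul_smul, Matrix.mul_assoc, ← Matrix.mul_assoc T, hTT]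
    simp [smul_smul]
  have hPH : Pᴴ = P := by simp [hP, Matrix.conjTranspose_smul, Matrix.conjTranspose_mul]
  have h : 1 - P = (1 - P)ᴴ * (1 - P) := by
    rw [Matrix.conjTranspose_sub, hPH, Matrix.conjTranspose_one]
    simp [sub_mul, mul_sub, hPP]
  rw [h]
  exact Matrix.posSemidef_conjTranspose_mul_self _

/-- The operator that splits off a qubit and projects it, together with the qubit of the shared
resource, onto the (unnormalized) maximally entangled state. -/
noncomputable def steer (U : Isometry I (I' × Fin 2)) (K : Type) [Fintype K] [DecidableEq K] :
    Matrix (I' × K) (I × (K × Fin 2)) ℂ :=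
  bellContraction I' K * (U.mat ⊗ₖ (1 : Matrix (K × Fin 2) (K × Fin 2) ℂ))

lemma steer_apply (U : Isometry I (I' × Fin 2)) (u : I') (k : K) (i : I) (l : K) (s : Fin 2) :
    steer U K (u, k) (i, (l, s)) = if k = l then U.mat (u, s) i else 0 := by
  simp only [steer, bellContraction, Matrix.mul_apply, Matrix.of_apply,
    Fintype.sum_prod_type, Matrix.kroneckerMap_apply, Matrix.one_apply, Prod.mk.injEq, ite_and]
  simp [Finset.sum_ite_eq, Finset.sum_ite_eq']

/-- Conjugating the failure projection by the isometry preserves positivity and sends the identity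
to the identity. -/
lemma posSemidef_one_sub_steer (U : Isometry I (I' × Fin 2)) :
    (1 - (1 / 2 : ℂ) • ((steer U K)ᴴ * steer U K)).PosSemidef := by
  set V := U.mat ⊗ₖ (1 : Matrix (K × Fin 2) (K × Fin 2) ℂ) with hV
  have hVV : Vᴴ * V = 1 := by
    rw [hV, Matrix.conjTranspose_kronecker, ← Matrix.mul_kronecker_mul, U.isometry]
    simp
  have h := (posSemidef_one_sub_bellContraction (I' := I') (K := K)).conjTranspose_mul_mul_same V
  rw [Matrix.mul_sub, Matrix.sub_mul, Matrix.mul_one, hVV] at h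
  simpa [steer, ← hV, Matrix.mul_assoc] using h

/-- Postselected teleportation: instead of sending the qubit that `U` splits off, a player can
project it, together with a shared maximally entangled qubit, onto the Bell state, and abort if
the projection fails. -/
noncomputable def POVM.steer {A : Type*} [Fintype A] (E : POVM (Option A) (I' × K))
    (U : Isometry I (I' × Fin 2)) : POVM (Option A) (I × (K × Fin 2)) where
  effect o := (1 / 2 : ℂ) • ((QComm.steer U K)ᴴ * E.effect o * QComm.steer U K) +
    o.elim (1 - (1 / 2 : ℂ) • ((QComm.steer U K)ᴴ * QComm.steer U K)) (fun _ => 0)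
  posSemidef o := by
    have h : ((1 / 2 : ℂ) • ((QComm.steer U K)ᴴ * E.effect o * QComm.steer U K)).PosSemidef :=
      ((E.posSemidef o).conjTranspose_mul_mul_same _).smul (by positivity)
    cases o with
    | none => exact h.add (posSemidef_one_sub_steer U)
    | some a => exact h.add .zero
  sum_eq_one := by
    rw [Finset.sum_add_distrib, ← Finset.smul_sum, ← Matrix.sum_mul, ← Matrix.mul_sum,
      E.sum_eq_one]
    simp

lemma POVM.steer_apply {A : Type*} [Fintype A] (E : POVM (Option A) (I' × K))
    (U : Isometry I (I' × Fin 2)) (a : A) (i j : I) (k l : K) (s t : Fin 2) :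
    (E.steer U).effect (some a) (i, (k, s)) (j, (l, t)) =
      (1 / 2) * ∑ u, ∑ v, star (U.mat (u, s) i) * E.effect (some a) (u, k) (v, l) *
        U.mat (v, t) j := by
  simp only [POVM.steer, Option.elim_some, add_zero, Matrix.smul_apply, smul_eq_mul,
    Matrix.mul_apply, Fintype.sum_prod_type, Matrix.conjTranspose_apply, QComm.steer_apply]
  simp only [apply_ite star, star_zero, mul_ite, ite_mul, zero_mul, mul_zero,
    Finset.sum_ite_eq', Finset.mem_univ, if_true, Finset.sum_mul]
  rw [Finset.sum_comm]

/-- Transport of a measurement along a bijection of the computational bases. -/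
def POVM.reindex {O : Type*} [Fintype O] (E : POVM O I) (e : I ≃ I') : POVM O I' where
  effect o := (E.effect o).submatrix e.symm e.symm
  posSemidef o := (E.posSemidef o).submatrix _
  sum_eq_one := by
    rw [← Matrix.submatrix_one_equiv e.symm, ← E.sum_eq_one]
    ext i j
    simp [Matrix.sum_apply]

/-- The same isometry, with the qubit that is split off written last. -/
def Isometry.swap (V : Isometry I (Fin 2 × I')) : Isometry I (I' × Fin 2) where
  mat := V.mat.submatrix Prod.swap id
  isometry := by
    rw [← V.isometry]
    ext i j
    simp only [Matrix.mul_apply, Matrix.conjTranspose_apply, Matrix.submatrix_apply, id]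
    exact Fintype.sum_equiv (Equiv.prodComm _ _) _ _ fun _ => rfl

/-- Adding an outcome that never occurs. -/
def POVM.withNone {A : Type*} [Fintype A] (E : POVM A I) : POVM (Option A) I where
  effect o := o.elim 0 E.effect
  posSemidef o := by
    cases o with
    | none => exact .zero
    | some a => exact E.posSemidef a
  sum_eq_one := by simp [Fintype.sum_option, E.sum_eq_one]

end Steering

/-! ### Attaching the maximally entangled resource -/

section Contract

variable {I I' J J' K : Type} [Fintype I] [DecidableEq I] [Fintype I'] [DecidableEq I']
  [Fintype J] [DecidableEq J] [Fintype J'] [DecidableEq J'] [Fintype K] [DecidableEq K]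

/-- The effect on the registers `I` and `J` obtained from effects on `I × K` and `J × K` by
attaching the unnormalized maximally entangled state on `K × K`. -/
def contract (E : Matrix (I × K) (I × K) ℂ) (F : Matrix (J × K) (J × K) ℂ) :
    Matrix (I × J) (I × J) ℂ :=
  Matrix.of fun p q => ∑ k, ∑ l, E (p.1, k) (q.1, l) * F (p.2, k) (q.2, l)

/-- The isometry, up to normalization, that attaches the maximally entangled state. -/
def attach (I J K : Type) [DecidableEq I] [DecidableEq J] [DecidableEq K] :
    Matrix ((I × K) × (J × K)) (I × J) ℂ :=
  Matrix.of fun u v => if u.1.1 = v.1 ∧ u.2.1 = v.2 ∧ u.1.2 = u.2.2 then 1 else 0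

lemma attach_conjTranspose_mul_mul (E : Matrix (I × K) (I × K) ℂ)
    (F : Matrix (J × K) (J × K) ℂ) :
    (attach I J K)ᴴ * (E ⊗ₖ F) * attach I J K = contract E F := by
  ext ⟨i, j⟩ ⟨i', j'⟩
  simp only [contract, attach, Matrix.mul_apply, Matrix.of_apply, Matrix.conjTranspose_apply,
    Fintype.sum_prod_type, Matrix.kroneckerMap_apply, ite_and, apply_ite star, star_zero,
    star_one, mul_ite, ite_mul, zero_mul, mul_zero, one_mul, mul_one, Finset.sum_ite_eq,
    Finset.sum_ite_eq', Finset.mem_univ, if_true, Finset.sum_ite_irrel, Finset.sum_const_zero]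
  rw [Finset.sum_comm]

/-- The case of identity effects; it gives the normalization of the attached state. -/
lemma attach_conjTranspose_mul_self :
    (attach I J K)ᴴ * attach I J K = (Fintype.card K : ℂ) • 1 := by
  have h := attach_conjTranspose_mul_mul (1 : Matrix (I × K) (I × K) ℂ)
    (1 : Matrix (J × K) (J × K) ℂ)
  rw [Matrix.one_kronecker_one, Matrix.mul_one] at h
  rw [h]
  ext ⟨i, j⟩ ⟨i', j'⟩
  by_cases hi : i = i' <;> by_cases hj : j = j' <;>
    simp [contract, Matrix.one_apply, hi, hj]

/-- Moving a qubit from the first register next to the shared resource. -/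
def bitLast (J K : Type) : (Fin 2 × J) × K ≃ J × (K × Fin 2) where
  toFun v := (v.1.2, (v.2, v.1.1))
  invFun v := ((v.2.2, v.1), v.2.1)

/-- Correctness of one teleportation from Alice to Bob: his half of the new pair plays the role of
the received qubit. The factor 1/2 comes from normalizing the Bell projection; the resource is still
unnormalized here. -/
lemma contract_steer_left {A B : Type*} [Fintype A] [Fintype B]
    (E : POVM (Option A) (I' × K)) (F : POVM (Option B) ((Fin 2 × J) × K))
    (U : Isometry I (I' × Fin 2)) (a : A) (b : B) :
    contract ((E.steer U).effect (some a)) ((F.reindex (bitLast J K)).effect (some b)) =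
      (1 / 2 : ℂ) • ((U.mat ⊗ₖ (1 : Matrix J J ℂ))ᴴ *
        (contract (E.effect (some a)) (F.effect (some b))).submatrix
          (Equiv.prodAssoc I' (Fin 2) J) (Equiv.prodAssoc I' (Fin 2) J) *
        (U.mat ⊗ₖ (1 : Matrix J J ℂ))) := by
  ext ⟨i, j⟩ ⟨i', j'⟩
  simp only [contract, Matrix.of_apply, POVM.steer_apply, POVM.reindex, bitLast,
    Matrix.submatrix_apply, Equiv.coe_fn_symm_mk, Fintype.sum_prod_type, Matrix.smul_apply,
    Matrix.mul_apply, Matrix.conjTranspose_apply, Matrix.kroneckerMap_apply, Matrix.one_apply,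
    Equiv.prodAssoc_apply, mul_ite, ite_mul, mul_one, mul_zero, zero_mul, apply_ite star,
    star_zero, Finset.sum_ite_eq', Finset.mem_univ, if_true, Finset.sum_mul, Finset.mul_sum,
    smul_eq_mul, Finset.sum_ite_irrel, Finset.sum_const_zero]
  simp only [← Fintype.sum_prod_type']
  -- Both sides sum the same terms over six indices, only in a different order.
  refine Fintype.sum_equiv ⟨fun (k, s, l, t, u, v) => (v, t, u, s, k, l),
    fun (v, t, u, s, k, l) => (k, s, l, t, u, v), fun _ => rfl, fun _ => rfl⟩ _ _ fun v => ?_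
  simp only [Equiv.coe_fn_mk]
  ring

/-- The mirror image; the swaps account for the qubit standing first in Bob's output and last in
Alice's new register. -/
lemma contract_steer_right {A B : Type*} [Fintype A] [Fintype B]
    (E : POVM (Option A) ((I × Fin 2) × K)) (F : POVM (Option B) (J' × K))
    (V : Isometry J (Fin 2 × J')) (a : A) (b : B) :
    contract ((E.reindex (((Equiv.prodComm _ _).prodCongr (Equiv.refl _)).trans
        (bitLast I K))).effect (some a))
        ((F.steer V.swap).effect (some b)) =
      (1 / 2 : ℂ) • (((1 : Matrix I I ℂ) ⊗ₖ V.mat)ᴴ *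
        (contract (E.effect (some a)) (F.effect (some b))).submatrix
          (Equiv.prodAssoc I (Fin 2) J').symm (Equiv.prodAssoc I (Fin 2) J').symm *
        ((1 : Matrix I I ℂ) ⊗ₖ V.mat)) := by
  ext ⟨i, j⟩ ⟨i', j'⟩
  simp only [contract, Matrix.of_apply, POVM.steer_apply, POVM.reindex, bitLast,
    Matrix.submatrix_apply, Equiv.coe_fn_symm_mk, Fintype.sum_prod_type, Matrix.smul_apply,
    Matrix.mul_apply, Matrix.conjTranspose_apply, Matrix.kroneckerMap_apply, Matrix.one_apply,
    Equiv.prodAssoc_symm_apply, mul_ite, ite_mul, mul_zero, zero_mul, apply_ite star,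
    star_zero, Finset.sum_ite_eq', Finset.mem_univ, if_true, Isometry.swap,
    Finset.sum_mul, Finset.mul_sum, smul_eq_mul, Equiv.symm_trans_apply,
    Equiv.prodCongr_symm, Equiv.prodCongr_apply, Equiv.prodComm_symm, Equiv.prodComm_apply,
    Prod.map, Prod.swap, Equiv.refl_symm, Equiv.refl_apply, id, one_mul,
    Finset.sum_ite_irrel, Finset.sum_const_zero]
  simp only [← Fintype.sum_prod_type']
  refine Fintype.sum_equiv ⟨fun (k, s, l, t, u, v) => (t, v, s, u, k, l),
    fun (t, v, s, u, k, l) => (k, s, l, t, u, v), fun _ => rfl, fun _ => rfl⟩ _ _ fun v => ?_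
  simp only [Equiv.coe_fn_mk]
  ring

end Contract

/-- Cyclicity of the trace: passes from pulled-back effects to evolved states. -/
lemma trace_conj_reindex_mul {m n r : Type} [Fintype m] [Fintype n] [Fintype r]
    (G : Matrix r r ℂ) (K : Matrix m n ℂ) (ρ : Matrix n n ℂ) (e : m ≃ r) :
    (Kᴴ * G.submatrix e e * K * ρ).trace =
      (G * Matrix.reindex e e (K * ρ * Kᴴ)).trace := by
  have h : (G * Matrix.reindex e e (K * ρ * Kᴴ)) =
      Matrix.reindex e e (G.submatrix e e * (K * ρ * Kᴴ)) := by
    rw [Matrix.reindex_apply, Matrix.reindex_apply, ← Matrix.submatrix_mul_equiv _ _ _ e.symm]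
    simp
  have h' : ∀ M : Matrix m m ℂ, (Matrix.reindex e e M).trace = M.trace := fun M =>
    Fintype.sum_equiv e.symm _ _ fun _ => rfl
  rw [h, h', Matrix.mul_assoc, Matrix.mul_assoc, Matrix.trace_mul_comm]
  simp only [Matrix.mul_assoc]

/-- Writing `M = Bᴴ * B`, cyclicity turns the trace into that of `B * ρ * Bᴴ`. -/
lemma trace_mul_nonneg {n : Type} [Fintype n] {M ρ : Matrix n n ℂ}
    (hM : M.PosSemidef) (hρ : ρ.PosSemidef) : 0 ≤ (M * ρ).trace := by
  classical
  obtain ⟨B, rfl⟩ := by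
    open scoped MatrixOrder in
    exact CStarAlgebra.nonneg_iff_eq_star_mul_self.mp hM.nonneg
  rw [Matrix.star_eq_conjTranspose, Matrix.mul_assoc, Matrix.trace_mul_comm]
  exact (hρ.mul_mul_conjTranspose_same B).trace_nonneg

/-! ### Simulating protocols without communication -/

section Protocol

variable {X Y A B : Type*} [Fintype A] [Fintype B] {I J : Type} [Fintype I] [DecidableEq I]
  [Fintype J] [DecidableEq J]

lemma QProtocol.prob_nonneg (P : QProtocol X Y A B I J) {ρ : Matrix (I × J) (I × J) ℂ}
    (hρ : ρ.PosSemidef) (x : X) (y : Y) (a : A) (b : B) : 0 ≤ P.prob ρ x y a b := by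
  induction P with
  | measure E F =>
    exact (Complex.nonneg_iff.1 (trace_mul_nonneg
      (((E x).posSemidef a).kronecker ((F y).posSemidef b)) hρ)).1
  | aliceSends U next ih => exact ih ((hρ.mul_mul_conjTranspose_same _).submatrix _)
  | bobSends V next ih => exact ih ((hρ.mul_mul_conjTranspose_same _).submatrix _)

lemma trace_reindex_conj {m n r : Type} [Fintype m] [Fintype n] [Fintype r] [DecidableEq n]
    [DecidableEq r] {K : Matrix m n ℂ} (hK : Kᴴ * K = 1) (ρ : Matrix n n ℂ) (e : m ≃ r) :
    (Matrix.reindex e e (K * ρ * Kᴴ)).trace = ρ.trace := by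
  classical
  have h := trace_conj_reindex_mul 1 K ρ e
  rwa [Matrix.one_mul, Matrix.submatrix_one_equiv, Matrix.mul_one, hK, Matrix.one_mul,
    eq_comm] at h

lemma QProtocol.sum_prob (P : QProtocol X Y A B I J) (ρ : Matrix (I × J) (I × J) ℂ)
    (x : X) (y : Y) : ∑ a, ∑ b, P.prob ρ x y a b = ρ.trace.re := by
  induction P with
  | measure E F =>
    simp only [QProtocol.prob, born, ← Complex.re_sum, ← Matrix.trace_sum, ← Matrix.sum_mul]
    have h : ∑ a, ∑ b, (E x).effect a ⊗ₖ (F y).effect b = 1 := by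
      rw [← Matrix.one_kronecker_one, ← (E x).sum_eq_one, ← (F y).sum_eq_one]
      ext ⟨i, j⟩ ⟨i', j'⟩
      simp only [Matrix.sum_apply, Matrix.kroneckerMap_apply, Finset.sum_mul_sum]
    rw [h, Matrix.one_mul]
  | aliceSends U next ih =>
    refine (ih _).trans (congrArg Complex.re (trace_reindex_conj ?_ _ _))
    rw [Matrix.conjTranspose_kronecker, ← Matrix.mul_kronecker_mul, (U x).isometry]
    simp
  | bobSends V next ih =>
    refine (ih _).trans (congrArg Complex.re (trace_reindex_conj ?_ _ _))
    rw [Matrix.conjTranspose_kronecker, ← Matrix.mul_kronecker_mul, (V y).isometry]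
    simp

/-- Postselected teleportation: with a maximally entangled resource of `t` qubit pairs, a protocol
of cost `t` can be replaced by local measurements that may abort. -/
theorem QProtocol.exists_simulation (P : QProtocol X Y A B I J) :
    ∃ (K : Type) (_ : Fintype K) (_ : DecidableEq K) (E : X → POVM (Option A) (I × K))
      (F : Y → POVM (Option B) (J × K)), Fintype.card K = 2 ^ P.cost ∧
      ∀ ρ x y a b,
        (contract ((E x).effect (some a)) ((F y).effect (some b)) * ρ).trace.re =
          (2 ^ P.cost : ℝ)⁻¹ * P.prob ρ x y a b := by
  induction P with
  | @measure I J _ _ _ _ E F =>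
    -- Without messages no entanglement is added, and abort never occurs.
    refine ⟨Unit, inferInstance, inferInstance,
      fun x => (E x).withNone.reindex (Equiv.prodPUnit I).symm,
      fun y => (F y).withNone.reindex (Equiv.prodPUnit J).symm, rfl, fun ρ x y a b => ?_⟩
    have h : contract (((E x).withNone.reindex (Equiv.prodPUnit I).symm).effect (some a))
        (((F y).withNone.reindex (Equiv.prodPUnit J).symm).effect (some b)) =
        (E x).effect a ⊗ₖ (F y).effect b := by
      ext ⟨i, j⟩ ⟨i', j'⟩
      simp [contract, POVM.reindex, POVM.withNone]
    simp [h, QProtocol.prob, QProtocol.cost, born]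
  | aliceSends U next ih =>
    -- The measurements are chosen before `ρ`, so `h` applies to the state after the input-dependent
    -- isometry.
    obtain ⟨K, _, _, E, F, hK, h⟩ := ih
    refine ⟨K × Fin 2, inferInstance, inferInstance, fun x => (E x).steer (U x),
      fun y => (F y).reindex (bitLast _ K), ?_, fun ρ x y a b => ?_⟩
    · simp [hK, QProtocol.cost, pow_succ]
    · rw [contract_steer_left, Matrix.smul_mul, Matrix.trace_smul, trace_conj_reindex_mul]
      rw [smul_eq_mul, show (1 / 2 : ℂ) = ((1 / 2 : ℝ) : ℂ) by norm_num, Complex.re_ofReal_mul,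
        h]
      simp only [QProtocol.prob, QProtocol.cost, pow_succ]
      ring
  | bobSends V next ih =>
    obtain ⟨K, _, _, E, F, hK, h⟩ := ih
    refine ⟨K × Fin 2, inferInstance, inferInstance,
      fun x => (E x).reindex (((Equiv.prodComm _ _).prodCongr (Equiv.refl _)).trans (bitLast _ K)),
      fun y => (F y).steer (V y).swap, ?_, fun ρ x y a b => ?_⟩
    · simp [hK, QProtocol.cost, pow_succ]
    · rw [contract_steer_right, Matrix.smul_mul, Matrix.trace_smul, trace_conj_reindex_mul]
      rw [smul_eq_mul, show (1 / 2 : ℂ) = ((1 / 2 : ℝ) : ℂ) by norm_num, Complex.re_ofReal_mul,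
        h]
      simp only [QProtocol.prob, QProtocol.cost, pow_succ]
      ring

/-- Needed because the infimum in `effStarErr` admits only distributions. -/
lemma ProducedWithQubits.isDistribution {t : ℕ} {p : X → Y → A → B → ℝ}
    (h : ProducedWithQubits t p) : IsDistribution p := by
  obtain ⟨I, J, _, _, _, _, ρ, P, hρ, -, hp⟩ := h
  refine ⟨fun x y a b => hp x y a b ▸ P.prob_nonneg hρ.1 x y a b, fun x y => ?_⟩
  simp only [← hp, P.sum_prob, hρ.2, Complex.one_re]

/-- One factor `2 ^ (-t)` comes from the Bell projections, another from normalizing the resource of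
dimension `2 ^ t` on each side. -/
theorem ProducedWithQubits.feasibleEfficiency {t : ℕ} {p : X → Y → A → B → ℝ}
    (h : ProducedWithQubits t p) : FeasibleEfficiency p ((4 ^ t)⁻¹ : ℝ≥0) := by
  obtain ⟨I, J, _, _, _, _, ρ, P, hρ, rfl, hp⟩ := h
  obtain ⟨K, _, _, E, F, hK, h⟩ := P.exists_simulation
  have hc : (Fintype.card K : ℂ) ≠ 0 := by simp [hK]
  set V := attach I J K with hV
  refine ⟨fun x y a b => born ((Fintype.card K : ℂ)⁻¹ • (V * ρ * Vᴴ)) ((E x).effect a)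
    ((F y).effect b), ⟨I × K, J × K, inferInstance, inferInstance, inferInstance, inferInstance,
      _, E, F, ⟨(hρ.1.mul_mul_conjTranspose_same V).smul (by positivity), ?_⟩,
      fun _ _ _ _ => rfl⟩, fun x y a b => ?_⟩
  · rw [Matrix.trace_smul, Matrix.trace_mul_comm, ← Matrix.mul_assoc,
      attach_conjTranspose_mul_self, Matrix.smul_mul, Matrix.one_mul, Matrix.trace_smul, hρ.2]
    simp [hc]
  · have hinv : (Fintype.card K : ℂ)⁻¹ = (((2 ^ P.cost)⁻¹ : ℝ) : ℂ) := by simp [hK]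
    beta_reduce
    -- Cyclicity moves `V` from the state onto the effects, where it becomes `contract`.
    rw [born, Matrix.mul_smul, Matrix.trace_smul, smul_eq_mul, hinv, Complex.re_ofReal_mul,
      Matrix.mul_assoc V, ← Matrix.mul_assoc, Matrix.trace_mul_comm, Matrix.mul_assoc,
      Matrix.trace_mul_comm ρ, ← Matrix.mul_assoc, attach_conjTranspose_mul_mul, h, hp]
    rw [show (4 : ℝ≥0) = 2 * 2 by norm_num]
    push_cast
    rw [mul_pow, mul_inv]
    ring

lemma ProducedWithQubits.effStar_le {t : ℕ} {p : X → Y → A → B → ℝ}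
    (h : ProducedWithQubits t p) : effStar p ≤ 4 ^ t := by
  rw [effStar, ENNReal.inv_le_iff_inv_le]
  refine le_trans (le_of_eq ?_)
    (le_iSup₂ (f := fun (ζ : ℝ≥0) (_ : FeasibleEfficiency p ζ) => (ζ : ℝ≥0∞))
      _ h.feasibleEfficiency)
  rw [ENNReal.coe_inv (by positivity)]
  push_cast
  rfl

lemma half_log2_four_pow (t : ℕ) :
    ((1 / 2 : ℝ) : EReal) * log2 (4 ^ t) = ((t : ℝ) : EReal) := by
  have h4 : ENNReal.log 4 = ((Real.log 4 : ℝ) : EReal) := by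
    have := ENNReal.log_ofReal_of_pos (x := 4) (by norm_num)
    simpa using this
  have h2 : Real.log 4 = 2 * Real.log 2 := by
    rw [show (4 : ℝ) = 2 ^ 2 by norm_num, Real.log_pow]
    norm_num
  have hpos : 0 < Real.log 2 := Real.log_pos one_lt_two
  rw [log2, ENNReal.log_pow, h4, show ((t : ℕ) : EReal) = ((t : ℝ) : EReal) from rfl,
    ← EReal.coe_mul, ← EReal.coe_div, ← EReal.coe_mul, h2]
  congr 1
  field_simp

end Protocol
end QComm

theorem theorem3p5 {X Y A B : Type*} [Fintype A] [Fintype B]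
    (p : X → Y → A → B → ℝ) (hp : IsDistribution p) (ε : ℝ) :
    ((1 / 2 : ℝ) : EReal) * log2 (effStarErr ε p) ≤ ((QStar ε p : ℝ≥0∞) : EReal) := by
  by_cases hQ : QStar ε p = ⊤
  · simp [hQ]
  obtain ⟨t, ⟨p', hp', hclose⟩, ht⟩ : ∃ t : ℕ, (∃ p' : X → Y → A → B → ℝ,
      ProducedWithQubits t p' ∧ L1Close ε p' p) ∧ QStar ε p = t := by
    have hne : Nonempty {t : ℕ // ∃ p' : X → Y → A → B → ℝ,
        ProducedWithQubits t p' ∧ L1Close ε p' p} := by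
      by_contra hne
      refine hQ (iInf₂_eq_top.2 fun t ht => (hne ⟨⟨t, ht⟩⟩).elim)
    -- A nonempty infimum in `ℕ∞` is attained, so an optimal protocol exists.
    obtain ⟨t, ht⟩ := ciInf_mem (fun t : {t : ℕ // ∃ p' : X → Y → A → B → ℝ,
        ProducedWithQubits t p' ∧ L1Close ε p' p} => ((t : ℕ) : ℕ∞))
    exact ⟨t, t.2, by rw [QStar, iInf_subtype', ← ht]⟩
  -- The output of the optimal protocol is itself a competitor in `effStarErr`.
  have hle : effStarErr ε p ≤ 4 ^ t :=
    (iInf₂_le p' ⟨hp'.isDistribution, hclose⟩).trans hp'.effStar_le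
  calc ((1 / 2 : ℝ) : EReal) * log2 (effStarErr ε p)
      ≤ ((1 / 2 : ℝ) : EReal) * log2 (4 ^ t) :=
        mul_le_mul_of_nonneg_left (EReal.div_le_div_right_of_nonneg
          (EReal.coe_nonneg.2 (Real.log_nonneg one_le_two)) (ENNReal.log_le_log hle))
          (EReal.coe_nonneg.2 (by norm_num))
    _ = ((QStar ε p : ℝ≥0∞) : EReal) := by
        rw [half_log2_four_pow, ht, ENat.toENNReal_coe]
        exact_mod_cast rfl
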